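/- Let $1\le p<n$, let $A\in\mathbb R^{n\times n}$ be symmetric with eigenvalues $\lambda_1\ge\dots\ge\lambda_n$ (with multiplicity), and assume the spectral gap $\delta=\lambda_p-\lambda_{p+1}$ is positive. Put $L=\lambda_1-\lambda_n$ and $c_Q=2/\pi^2$. For $X\in\mathbb R^{n\times p}$ with $X^TX=I$ let $\phi(X)=-\tfrac12\operatorname{Tr}(X^TAX)$, $\operatorname{grad}\phi(X)=-(AX-X(X^TAX))$, and let $\phi^*$ be the minimum of $\phi$ over all such $X$. Let the columns of $V_\alpha\in\mathbb R^{n\times p}$ be orthonormal eigenvectors of $A$ for $\lambda_1,\dots,\lambda_p$. The principal angles $0\le\theta_1\le\dots\le\theta_p\le\pi/2$ between $\operatorname{span}(X)$ and $\operatorname{span}(V_\alpha)$ are given by a singular value decomposition $V_\alpha^TX=U_1\operatorname{diag}(\cos\theta_1,\dots,\cos\theta_p)V_1^T$ with $U_1,V_1$ orthogonal; put $a(X)=\theta_p/\tan\theta_p$, with the continuous extension $a(X)=1$ if $\theta_p=0$ and $a(X)=0$ if $\theta_p=\pi/2$. One step of Riemannian gradient descent with exact line search from $X_k$ (with $X_k^TX_k=I$)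 is the following. Let $G=\operatorname{grad}\phi(X_k)$, diagonalize $G^TG=V\operatorname{diag}(\beta_1,\dots,\beta_p)V^T$ with $V$ orthogonal, put $\alpha_i=(V^TX_k^TAX_kV)_{ii}$ and $\gamma_i=(V^TG^TAGV)_{ii}$, let $\mu$ be a minimizer over $[0,\infty)$ of $$\mu\mapsto-\frac12\sum_{i=1}^p\frac{\alpha_i+2\beta_i\mu+\gamma_i\mu^2}{1+\beta_i\mu^2},$$ and set $X_{k+1}=(X_k-\mu G)\,V\operatorname{diag}\big((1+\mu^2\beta_i)^{-1/2}\big)V^T$ (the polar factor of $X_k-\mu G$). Then every such step satisfies $$\phi(X_{k+1})-\phi^*\le\Big(1-\frac85\,c_Q\,a^2(X_k)\,\frac{\delta}{L}\Big)\big(\phi(X_k)-\phi^*\big).$$ -/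

import Mathlib

open scoped Matrix

noncomputable section

namespace GrassmannGD

/-- The objective `φ(X) = -½ Tr(Xᵀ A X)`. -/
def phi {n p : ℕ} (A : Matrix (Fin n) (Fin n) ℝ) (X : Matrix (Fin n) (Fin p) ℝ) : ℝ :=
  -(1 / 2) * (Xᵀ * A * X).trace

/-- The Stiefel set: matrices with orthonormal columns.  Each of them represents the point of the
Grassmann manifold given by its column span. -/
def stiefel (n p : ℕ) : Set (Matrix (Fin n) (Fin p) ℝ) :=
  {X | Xᵀ * X = 1}

/-- The optimal value `φ*`: the minimum of `φ` over matrices with orthonormal columns. -/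
def phiStar {n : ℕ} (A : Matrix (Fin n) (Fin n) ℝ) (p : ℕ) : ℝ :=
  sInf (phi A '' stiefel n p)

/-- The Riemannian gradient `grad φ(X) = -(A X - X C)`, `C = Xᵀ A X`. -/
def grad {n p : ℕ} (A : Matrix (Fin n) (Fin n) ℝ) (X : Matrix (Fin n) (Fin p) ℝ) :
    Matrix (Fin n) (Fin p) ℝ :=
  -(A * X - X * (Xᵀ * A * X))

/-- The line-search function
`μ ↦ -½ ∑ᵢ (αᵢ + 2 βᵢ μ + γᵢ μ²) / (1 + βᵢ μ²)`. -/
def lineObjective {p : ℕ} (α β γ : Fin p → ℝ) (μ : ℝ) : ℝ :=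
  -(1 / 2) * ∑ i, (α i + 2 * β i * μ + γ i * μ ^ 2) / (1 + β i * μ ^ 2)

/-- `X'` is obtained from `X` by one step of Riemannian gradient descent with exact line search:
with `G = grad φ(X)`, diagonalize `Gᵀ G = V D_β Vᵀ` with `V` orthogonal, put
`αᵢ = ((XV)ᵀ A (XV))ᵢᵢ` and `γᵢ = ((GV)ᵀ A (GV))ᵢᵢ`, let `μ` minimize the line-search function
over `[0, ∞)`, and let `X' = (X - μ G) V (I + μ² D_β)^{-1/2} Vᵀ`, which is the polar factor
of `X - μ G`. -/
def IsGradientStep {n p : ℕ} (A : Matrix (Fin n) (Fin n) ℝ)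
    (X X' : Matrix (Fin n) (Fin p) ℝ) : Prop :=
  ∃ V ∈ Matrix.orthogonalGroup (Fin p) ℝ, ∃ (β : Fin p → ℝ) (μ : ℝ),
    (grad A X)ᵀ * grad A X = V * Matrix.diagonal β * Vᵀ ∧
    0 ≤ μ ∧
    IsMinOn
      (lineObjective
        (fun i => ((X * V)ᵀ * A * (X * V)) i i) β
        (fun i => ((grad A X * V)ᵀ * A * (grad A X * V)) i i))
      (Set.Ici 0) μ ∧
    X' = (X - μ • grad A X) * V *
      Matrix.diagonal (fun i => (Real.sqrt (1 + μ ^ 2 * β i))⁻¹) * Vᵀ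

/-- The eigenvalues of a symmetric matrix with multiplicity in non-increasing order:
`eig hA i` is the `(i+1)`-st largest one. -/
def eig {n : ℕ} {A : Matrix (Fin n) (Fin n) ℝ} (hA : A.IsHermitian) (i : Fin n) : ℝ :=
  hA.eigenvalues₀ (Fin.cast (Fintype.card_fin n).symm i)

/-- The columns of `W` are orthonormal eigenvectors of `A` for its `p` largest eigenvalues, so
they form an orthonormal basis of the `p`-th dominant subspace. -/
def IsDominantBasis {n p : ℕ} {A : Matrix (Fin n) (Fin n) ℝ} (hA : A.IsHermitian) (hpn : p ≤ n)
    (W : Matrix (Fin n) (Fin p) ℝ) : Prop :=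
  W ∈ stiefel n p ∧
    A * W = W * Matrix.diagonal (fun i : Fin p => eig hA (Fin.castLE hpn i))

/-- `0 ≤ θ₁ ≤ ⋯ ≤ θ_p ≤ π/2` are the principal angles between the column spans of `X` and `Y`
(both with orthonormal columns): `Yᵀ X = U (cos θ) Vᵀ` is a singular value decomposition. -/
def IsPrincipalAngles {n p : ℕ} (X Y : Matrix (Fin n) (Fin p) ℝ) (θ : Fin p → ℝ) : Prop :=
  Monotone θ ∧ (∀ i, θ i ∈ Set.Icc 0 (Real.pi / 2)) ∧
    ∃ U ∈ Matrix.orthogonalGroup (Fin p) ℝ, ∃ V ∈ Matrix.orthogonalGroup (Fin p) ℝ,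
      Yᵀ * X = U * Matrix.diagonal (fun i => Real.cos (θ i)) * Vᵀ

/-- `t / tan t` on `[0, π/2]`, extended by continuity to the two end points. -/
def angleFactor (t : ℝ) : ℝ :=
  if t = 0 then 1 else if t = Real.pi / 2 then 0 else t / Real.tan t

/-- The constant `c_Q = 2/π²`. -/
def cQ : ℝ := 2 / Real.pi ^ 2

end GrassmannGD

end

namespace GrassmannGD

/-! Two estimates are multiplied. Write `G = grad φ(X)`, `D = φ(X) - φ(W)`. Sufficient decrease
(`phi_step_le`): exact line search does at least as well as the fixed step `1/L`, and there each
summand of the line-search function can be bounded separately, giving a decrease of at least `2/(5L)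
‖G‖²`. Gradient dominance (`gradient_dominance`): `2δ cos²θ_p D ≤ ‖G‖²`. Move `X` to the basis `W
(XᵀW)⁻¹` of the dominant subspace. The displacement `Z` has `⟨G, Z⟩ = -2D` exactly and `‖Z‖² = ∑
tan²θᵢ ≤ cos⁻²θ_p ∑ sin²θᵢ`, while quadratic growth (`phi_quadratic_growth`) gives `δ ∑ sin²θᵢ ≤
2D`. Cauchy–Schwarz concludes. The product has rate `(4/5) cos²θ_p δ/L`, and Jordan's inequality
gives `cos²θ_p ≥ 2 c_Q a²`. -/

/-! ### Spectral decomposition and Rayleigh quotient bounds -/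

theorem eig_antitone {n : ℕ} {A : Matrix (Fin n) (Fin n) ℝ} (hA : A.IsHermitian) :
    Antitone (eig hA) := fun _ _ h => hA.eigenvalues₀_antitone h

/-- `hA.eigenvalues` is ordered only up to an arbitrary relabelling of `Fin n`; the equivalence `e`
undoes it, so that the diagonal is sorted. -/
theorem exists_orthogonal_diagonalization {n : ℕ} {A : Matrix (Fin n) (Fin n) ℝ}
    (hA : A.IsHermitian) :
    ∃ U : Matrix (Fin n) (Fin n) ℝ, Uᵀ * U = 1 ∧ U * Uᵀ = 1 ∧
      A = U * Matrix.diagonal (eig hA) * Uᵀ := by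
  let e : Fin n ≃ Fin n := (finCongr (Fintype.card_fin n).symm).trans
    (Fintype.equivOfCardEq (Fintype.card_fin (Fintype.card (Fin n))))
  let Q : Matrix (Fin n) (Fin n) ℝ := hA.eigenvectorUnitary
  have hQ1 : Qᵀ * Q = 1 := by
    have := Unitary.coe_star_mul_self hA.eigenvectorUnitary
    simpa [Q, Matrix.star_eq_conjTranspose] using this
  have hQ2 : Q * Qᵀ = 1 := mul_eq_one_comm.mp hQ1
  have hd : Matrix.diagonal (eig hA) = (Matrix.diagonal hA.eigenvalues).submatrix e e := by
    rw [Matrix.submatrix_diagonal_equiv]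
    congr 1
    funext i
    simp [eig, Matrix.IsHermitian.eigenvalues, e]
  have hs : A = Q * Matrix.diagonal hA.eigenvalues * Qᵀ := by
    have := hA.spectral_theorem
    rw [Unitary.conjStarAlgAut_apply] at this
    simpa [Q, Matrix.star_eq_conjTranspose, Function.comp_def] using this
  refine ⟨Q.submatrix id e, ?_, ?_, ?_⟩
  · rw [Matrix.transpose_submatrix, Matrix.submatrix_mul _ _ e id e Function.bijective_id |>.symm,
      hQ1, Matrix.submatrix_one_equiv]
  · rw [Matrix.transpose_submatrix, Matrix.submatrix_mul_equiv, hQ2]; simp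
  · rw [hd, Matrix.transpose_submatrix, Matrix.submatrix_mul_equiv, Matrix.submatrix_mul_equiv, ← hs]
    simp

theorem trace_transpose_mul_eq_sum {m k : ℕ} (M N : Matrix (Fin m) (Fin k) ℝ) :
    (Mᵀ * N).trace = ∑ x : Fin k × Fin m, M x.2 x.1 * N x.2 x.1 := by
  rw [Fintype.sum_prod_type]
  simp [Matrix.trace, Matrix.mul_apply]

theorem transpose_mul_self_apply {m k : ℕ} (M : Matrix (Fin m) (Fin k) ℝ) (i : Fin k) :
    (Mᵀ * M) i i = ∑ j, M j i ^ 2 := by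
  simp [Matrix.mul_apply, pow_two]

theorem trace_transpose_mul_sq_le {m k : ℕ} (M N : Matrix (Fin m) (Fin k) ℝ) :
    (Mᵀ * N).trace ^ 2 ≤ (Mᵀ * M).trace * (Nᵀ * N).trace := by
  simp only [trace_transpose_mul_eq_sum, ← pow_two]
  exact Finset.sum_mul_sq_le_sq_mul_sq _ _ _

theorem trace_transpose_mul_self_nonneg {m k : ℕ} (M : Matrix (Fin m) (Fin k) ℝ) :
    0 ≤ (Mᵀ * M).trace := by
  rw [trace_transpose_mul_eq_sum]
  exact Finset.sum_nonneg fun _ _ => mul_self_nonneg _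

/-- The diagonal of `Mᵀ A M` in an eigenbasis of `A`. -/
theorem transpose_mul_conj_mul_apply {n k : ℕ} (U : Matrix (Fin n) (Fin n) ℝ) (d : Fin n → ℝ)
    (M : Matrix (Fin n) (Fin k) ℝ) (i : Fin k) :
    (Mᵀ * (U * Matrix.diagonal d * Uᵀ) * M) i i = ∑ j, d j * (Uᵀ * M) j i ^ 2 := by
  have : Mᵀ * (U * Matrix.diagonal d * Uᵀ) * M
      = (Uᵀ * M)ᵀ * (Matrix.diagonal d * (Uᵀ * M)) := by
    simp [Matrix.mul_assoc]
  rw [this, Matrix.mul_apply]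
  refine Finset.sum_congr rfl fun j _ => ?_
  rw [Matrix.diagonal_mul, Matrix.transpose_apply]
  ring

theorem transpose_mul_self_apply_of_orthogonal {n k : ℕ} {U : Matrix (Fin n) (Fin n) ℝ}
    (hU : U * Uᵀ = 1) (M : Matrix (Fin n) (Fin k) ℝ) (i : Fin k) :
    (Mᵀ * M) i i = ∑ j, (Uᵀ * M) j i ^ 2 := by
  rw [← transpose_mul_self_apply, Matrix.transpose_mul, Matrix.transpose_transpose,
    Matrix.mul_assoc, ← Matrix.mul_assoc U, hU, Matrix.one_mul]

theorem rayleigh_le {n k : ℕ} (hn : 0 < n) {A : Matrix (Fin n) (Fin n) ℝ} (hA : A.IsHermitian)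
    (M : Matrix (Fin n) (Fin k) ℝ) (i : Fin k) :
    (Mᵀ * A * M) i i ≤ eig hA ⟨0, hn⟩ * (Mᵀ * M) i i := by
  obtain ⟨U, -, hU, hs⟩ := exists_orthogonal_diagonalization hA
  have h1 := transpose_mul_conj_mul_apply U (eig hA) M i
  rw [← hs] at h1
  rw [h1, transpose_mul_self_apply_of_orthogonal hU, Finset.mul_sum]
  exact Finset.sum_le_sum fun j _ =>
    mul_le_mul_of_nonneg_right (eig_antitone hA (Fin.mk_le_of_le_val (Nat.zero_le _))) (sq_nonneg _)

theorem le_rayleigh {n k : ℕ} (hn : 0 < n) {A : Matrix (Fin n) (Fin n) ℝ} (hA : A.IsHermitian)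
    (M : Matrix (Fin n) (Fin k) ℝ) (i : Fin k) :
    eig hA ⟨n - 1, Nat.sub_lt hn one_pos⟩ * (Mᵀ * M) i i ≤ (Mᵀ * A * M) i i := by
  obtain ⟨U, -, hU, hs⟩ := exists_orthogonal_diagonalization hA
  have h1 := transpose_mul_conj_mul_apply U (eig hA) M i
  rw [← hs] at h1
  rw [h1, transpose_mul_self_apply_of_orthogonal hU, Finset.mul_sum]
  exact Finset.sum_le_sum fun j _ =>
    mul_le_mul_of_nonneg_right (eig_antitone hA (Fin.le_def.mpr (by simp; omega))) (sq_nonneg _)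

/-- Each eigenvalue satisfies `(λ₁ - λ)(λ - λₙ) ≥ 0`, so `(A - λ₁)(A - λₙ)` is negative
semidefinite. -/
theorem sq_rayleigh_le {n k : ℕ} (hn : 0 < n) {A : Matrix (Fin n) (Fin n) ℝ} (hA : A.IsHermitian)
    (M : Matrix (Fin n) (Fin k) ℝ) (i : Fin k) :
    (Mᵀ * (A * A) * M) i i ≤
      (eig hA ⟨0, hn⟩ + eig hA ⟨n - 1, Nat.sub_lt hn one_pos⟩) * (Mᵀ * A * M) i i
        - eig hA ⟨0, hn⟩ * eig hA ⟨n - 1, Nat.sub_lt hn one_pos⟩ * (Mᵀ * M) i i := by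
  obtain ⟨U, hU', hU, hs⟩ := exists_orthogonal_diagonalization hA
  have h1 := transpose_mul_conj_mul_apply U (eig hA) M i
  rw [← hs] at h1
  have hs2 : A * A = U * Matrix.diagonal (fun j => eig hA j * eig hA j) * Uᵀ := by
    conv_lhs => rw [hs]
    rw [← Matrix.diagonal_mul_diagonal]
    calc U * Matrix.diagonal (eig hA) * Uᵀ * (U * Matrix.diagonal (eig hA) * Uᵀ)
        = U * Matrix.diagonal (eig hA) * (Uᵀ * U) * Matrix.diagonal (eig hA) * Uᵀ := by
          simp only [Matrix.mul_assoc]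
      _ = _ := by rw [hU', Matrix.mul_one]; simp only [Matrix.mul_assoc]
  rw [hs2, transpose_mul_conj_mul_apply, h1, transpose_mul_self_apply_of_orthogonal hU,
    Finset.mul_sum, Finset.mul_sum, ← Finset.sum_sub_distrib]
  refine Finset.sum_le_sum fun j _ => ?_
  have h0 : eig hA j ≤ eig hA ⟨0, hn⟩ := eig_antitone hA (Fin.mk_le_of_le_val (Nat.zero_le _))
  have h2 : eig hA ⟨n - 1, Nat.sub_lt hn one_pos⟩ ≤ eig hA j :=
    eig_antitone hA (Fin.le_def.mpr (by simp; omega))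
  nlinarith [mul_nonneg (mul_nonneg (sub_nonneg.mpr h0) (sub_nonneg.mpr h2))
    (sq_nonneg ((Uᵀ * M) j i))]

theorem sum_eq_sum_castLE {n p : ℕ} (hpn : p ≤ n) (f : Fin n → ℝ)
    (hf : ∀ j : Fin n, p ≤ j → f j = 0) :
    ∑ j, f j = ∑ i : Fin p, f (Fin.castLE hpn i) := by
  symm
  refine (Finset.sum_map Finset.univ (Fin.castLEEmb hpn) f).symm.trans ?_
  refine Finset.sum_subset (Finset.subset_univ _) fun j _ hj => hf j ?_
  by_contra h
  exact hj (Finset.mem_map.mpr ⟨⟨j, not_le.mp h⟩, Finset.mem_univ _, rfl⟩)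

/-- On the orthogonal complement of a dominant basis the Rayleigh quotient is at most the next
eigenvalue. -/
theorem rayleigh_le_of_orthogonal_dominant {n p k : ℕ} (hp : 0 < p) (hpn : p < n)
    {A : Matrix (Fin n) (Fin n) ℝ} (hA : A.IsHermitian)
    (hgap : eig hA ⟨p, hpn⟩ < eig hA ⟨p - 1, (p.sub_le 1).trans_lt hpn⟩)
    {W : Matrix (Fin n) (Fin p) ℝ} (hW : IsDominantBasis hA hpn.le W)
    (M : Matrix (Fin n) (Fin k) ℝ) (hM : Wᵀ * M = 0) (i : Fin k) :
    (Mᵀ * A * M) i i ≤ eig hA ⟨p, hpn⟩ * (Mᵀ * M) i i := by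
  obtain ⟨U, hU', hU, hs⟩ := exists_orthogonal_diagonalization hA
  obtain ⟨hW1, hW2⟩ := hW
  have h1 := transpose_mul_conj_mul_apply U (eig hA) M i
  rw [← hs] at h1
  set S := Uᵀ * W with hS
  have hWS : W = U * S := by rw [hS, ← Matrix.mul_assoc, hU, Matrix.one_mul]
  have hDS : Matrix.diagonal (eig hA) * S
      = S * Matrix.diagonal (fun i : Fin p => eig hA (Fin.castLE hpn.le i)) := by
    rw [hS, Matrix.mul_assoc Uᵀ W, ← hW2]
    conv_rhs => rw [hs]
    simp only [← Matrix.mul_assoc]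
    rw [hU', Matrix.one_mul]
  -- Eigenvectors for different eigenvalues are orthogonal. The gap separates the first `p`
  -- eigenvalues from the rest, so `W` lies in the span of the first `p` columns of `U`; by
  -- dimension it fills that span, and `Wᵀ M = 0` kills the first `p` rows of `Uᵀ M`.
  have hS0 : ∀ (j : Fin n) (l : Fin p), p ≤ j → S j l = 0 := by
    intro j l hj
    have := congrFun (congrFun hDS j) l
    rw [Matrix.diagonal_mul, Matrix.mul_diagonal] at this
    have h2 : eig hA j ≤ eig hA ⟨p, hpn⟩ := eig_antitone hA (Fin.le_def.mpr hj)
    have h3 : eig hA ⟨p - 1, (p.sub_le 1).trans_lt hpn⟩ ≤ eig hA (Fin.castLE hpn.le l) :=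
      eig_antitone hA (Fin.le_def.mpr (by simp; omega))
    have h4 : (eig hA (Fin.castLE hpn.le l) - eig hA j) * S j l = 0 := by linarith
    rcases mul_eq_zero.mp h4 with h5 | h5
    · linarith
    · exact h5
  let N : Matrix (Fin p) (Fin p) ℝ := S.submatrix (Fin.castLE hpn.le) id
  have hSS : Sᵀ * S = 1 := by
    rw [hS, Matrix.transpose_mul, Matrix.transpose_transpose, Matrix.mul_assoc,
      ← Matrix.mul_assoc U, hU, Matrix.one_mul]
    exact hW1
  have hN : Nᵀ * N = 1 := by
    rw [← hSS]
    ext a b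
    simp only [Matrix.mul_apply, Matrix.transpose_apply]
    rw [sum_eq_sum_castLE hpn.le _ fun j hj => by rw [hS0 j a hj, zero_mul]]
    rfl
  let T : Matrix (Fin p) (Fin k) ℝ := (Uᵀ * M).submatrix (Fin.castLE hpn.le) id
  have hNT : Nᵀ * T = 0 := by
    rw [← hM, hWS, Matrix.transpose_mul, Matrix.mul_assoc]
    ext a b
    rw [Matrix.mul_apply, Matrix.mul_apply]
    simp only [Matrix.transpose_apply]
    rw [sum_eq_sum_castLE hpn.le (fun j => S j a * (Uᵀ * M) j b)
      fun j hj => by rw [hS0 j a hj, zero_mul]]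
    rfl
  have hT : T = 0 := by
    rw [← Matrix.one_mul T, ← mul_eq_one_comm.mp hN, Matrix.mul_assoc, hNT, Matrix.mul_zero]
  rw [h1, transpose_mul_self_apply_of_orthogonal hU, Finset.mul_sum]
  refine Finset.sum_le_sum fun j _ => ?_
  rcases lt_or_ge (j : ℕ) p with hj | hj
  · have : (Uᵀ * M) j i = 0 := congrFun (congrFun hT ⟨j, hj⟩) i
    simp [this]
  · exact mul_le_mul_of_nonneg_right (eig_antitone hA (Fin.le_def.mpr hj)) (sq_nonneg _)

/-! ### Optimal value and quadratic growth -/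

theorem phi_dominant {n p : ℕ} (hpn : p ≤ n) {A : Matrix (Fin n) (Fin n) ℝ} (hA : A.IsHermitian)
    {W : Matrix (Fin n) (Fin p) ℝ} (hW : IsDominantBasis hA hpn W) :
    phi A W = -(1 / 2) * ∑ i : Fin p, eig hA (Fin.castLE hpn i) := by
  have h : Wᵀ * W = 1 := hW.1
  rw [phi, Matrix.mul_assoc, hW.2, ← Matrix.mul_assoc, h, Matrix.one_mul, Matrix.trace_diagonal]

/-- Quadratic growth of `φ` in terms of `∑ sin² θᵢ = p - ‖Wᵀ Y‖²`. -/
theorem phi_quadratic_growth {n p : ℕ} (hp : 0 < p) (hpn : p < n)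
    {A : Matrix (Fin n) (Fin n) ℝ} (hA : A.IsHermitian)
    (hgap : eig hA ⟨p, hpn⟩ < eig hA ⟨p - 1, (p.sub_le 1).trans_lt hpn⟩)
    {W : Matrix (Fin n) (Fin p) ℝ} (hW : IsDominantBasis hA hpn.le W)
    {Y : Matrix (Fin n) (Fin p) ℝ} (hY : Y ∈ stiefel n p) :
    0 ≤ p - ((Wᵀ * Y)ᵀ * (Wᵀ * Y)).trace ∧
    (eig hA ⟨p - 1, (p.sub_le 1).trans_lt hpn⟩ - eig hA ⟨p, hpn⟩) * (p - ((Wᵀ * Y)ᵀ * (Wᵀ * Y)).trace) ≤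
      2 * (phi A Y - phi A W) := by
  have hW1 : Wᵀ * W = 1 := hW.1
  have hY1 : Yᵀ * Y = 1 := hY
  have hAt : Aᵀ = A := by simpa using hA.eq
  have hWA : Wᵀ * A = Matrix.diagonal (fun i : Fin p => eig hA (Fin.castLE hpn.le i)) * Wᵀ := by
    have := congrArg Matrix.transpose hW.2
    simpa [Matrix.transpose_mul, hAt] using this
  set Λ := Matrix.diagonal (fun i : Fin p => eig hA (Fin.castLE hpn.le i)) with hΛ
  set Q := Wᵀ * Y with hQ
  have hQt : Qᵀ = Yᵀ * W := by rw [hQ, Matrix.transpose_mul, Matrix.transpose_transpose]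
  have cancel : ∀ (B : Matrix (Fin p) (Fin p) ℝ), Wᵀ * (W * B) = B := fun B => by
    rw [← Matrix.mul_assoc, hW1, Matrix.one_mul]
  -- residual of the columns of `Y`
  set M := Y - W * Q with hMdef
  have hWM : Wᵀ * M = 0 := by rw [hMdef, Matrix.mul_sub, cancel, ← hQ, sub_self]
  have hMM : Mᵀ * M = 1 - Qᵀ * Q := by
    have : Mᵀ * M = Yᵀ * M := by
      conv_lhs => rw [hMdef]
      rw [Matrix.transpose_sub, Matrix.sub_mul, Matrix.transpose_mul, Matrix.mul_assoc, hWM,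
        Matrix.mul_zero, sub_zero]
    rw [this, hMdef, Matrix.mul_sub, hY1, ← Matrix.mul_assoc, ← hQt]
  have hMA : Mᵀ * A * M = Yᵀ * A * Y - Qᵀ * Λ * Q := by
    have hWAM : Wᵀ * (A * M) = 0 := by
      rw [← Matrix.mul_assoc, hWA, Matrix.mul_assoc, hWM, Matrix.mul_zero]
    have : Mᵀ * A * M = Yᵀ * (A * M) := by
      rw [Matrix.mul_assoc]
      conv_lhs => rw [hMdef]
      rw [Matrix.transpose_sub, Matrix.sub_mul, Matrix.transpose_mul, Matrix.mul_assoc Qᵀ, ← hMdef,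
        hWAM]
      simp
    rw [this, hMdef, Matrix.mul_sub, Matrix.mul_sub, ← Matrix.mul_assoc A W, hW.2,
      ← hΛ, hQt]
    simp only [Matrix.mul_assoc]
  -- `1 - Q Qᵀ` is the Gram matrix of the residual of `W` after projection onto the span of `Y`.
  have hWQ : ∀ i, (Q * Qᵀ) i i ≤ 1 := by
    intro i
    have h0 : (W - Y * Qᵀ)ᵀ * (W - Y * Qᵀ) = 1 - Q * Qᵀ := by
      have e1 : Yᵀ * (W - Y * Qᵀ) = 0 := by
        rw [Matrix.mul_sub, ← Matrix.mul_assoc, hY1, Matrix.one_mul, hQt, sub_self]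
      rw [Matrix.transpose_sub, Matrix.sub_mul, Matrix.transpose_mul Y, Matrix.mul_assoc _ Yᵀ, e1,
        Matrix.mul_zero, sub_zero, Matrix.mul_sub, hW1, ← Matrix.mul_assoc]
    have h1 := congrFun (congrFun h0 i) i
    rw [transpose_mul_self_apply, Matrix.sub_apply, Matrix.one_apply_eq] at h1
    have : (0 : ℝ) ≤ ∑ j, (W - Y * Qᵀ) j i ^ 2 := Finset.sum_nonneg fun _ _ => sq_nonneg _
    linarith
  have htr : (Qᵀ * Q).trace = ∑ i, (Q * Qᵀ) i i := by rw [Matrix.trace_mul_comm]; rfl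
  have hS : (p : ℝ) - (Qᵀ * Q).trace = ∑ i : Fin p, (1 - (Q * Qᵀ) i i) := by
    rw [htr, Finset.sum_sub_distrib]; simp
  have htrΛ : (Qᵀ * Λ * Q).trace = ∑ i, eig hA (Fin.castLE hpn.le i) * (Q * Qᵀ) i i := by
    rw [Matrix.mul_assoc, Matrix.trace_mul_comm, Matrix.mul_assoc]
    simp [Matrix.trace, hΛ, Matrix.diagonal_mul]
  have htrM : (Mᵀ * A * M).trace ≤ eig hA ⟨p, hpn⟩ * (Mᵀ * M).trace := by
    simp only [Matrix.trace, Matrix.diag_apply, Finset.mul_sum]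
    exact Finset.sum_le_sum fun i _ => rayleigh_le_of_orthogonal_dominant hp hpn hA hgap hW M hWM i
  rw [hMA, hMM, Matrix.trace_sub, Matrix.trace_sub, Matrix.trace_one, Fintype.card_fin] at htrM
  -- The part of `Y` along `W` loses at least `λ_p` per unit of missing weight; the residual `M`
  -- recovers at most `λ_{p+1}` per unit (`htrM`). The difference is the gap.
  have htop : eig hA ⟨p - 1, (p.sub_le 1).trans_lt hpn⟩ * ∑ i : Fin p, (1 - (Q * Qᵀ) i i) ≤
      ∑ i : Fin p, eig hA (Fin.castLE hpn.le i) - (Qᵀ * Λ * Q).trace := by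
    rw [htrΛ, ← Finset.sum_sub_distrib, Finset.mul_sum]
    refine Finset.sum_le_sum fun i _ => ?_
    have h3 : eig hA ⟨p - 1, (p.sub_le 1).trans_lt hpn⟩ ≤ eig hA (Fin.castLE hpn.le i) :=
      eig_antitone hA (Fin.le_def.mpr (by simp; omega))
    nlinarith [hWQ i]
  constructor
  · rw [hS]
    exact Finset.sum_nonneg fun i _ => sub_nonneg.mpr (hWQ i)
  · rw [phi_dominant hpn.le hA hW, phi]
    rw [← hS] at htop
    linarith

/-- Equality holds, but this direction is all that is needed: it bounds `φ(X) - φ*` by `φ(X) -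
φ(W)`. -/
theorem phi_dominant_le_phiStar {n p : ℕ} (hp : 0 < p) (hpn : p < n)
    {A : Matrix (Fin n) (Fin n) ℝ} (hA : A.IsHermitian)
    (hgap : eig hA ⟨p, hpn⟩ < eig hA ⟨p - 1, (p.sub_le 1).trans_lt hpn⟩)
    {W : Matrix (Fin n) (Fin p) ℝ} (hW : IsDominantBasis hA hpn.le W) :
    phi A W ≤ phiStar A p := by
  refine le_csInf ⟨_, W, hW.1, rfl⟩ ?_
  rintro _ ⟨Y, hY, rfl⟩
  obtain ⟨h1, h2⟩ := phi_quadratic_growth hp hpn hA hgap hW hY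
  nlinarith [mul_nonneg (sub_nonneg.mpr hgap.le) h1]

/-! ### The Riemannian gradient and gradient dominance -/

theorem transpose_mul_grad {n p : ℕ} (A : Matrix (Fin n) (Fin n) ℝ)
    {X : Matrix (Fin n) (Fin p) ℝ} (hX : X ∈ stiefel n p) : Xᵀ * grad A X = 0 := by
  have hX1 : Xᵀ * X = 1 := hX
  rw [grad, Matrix.mul_neg, Matrix.mul_sub, ← Matrix.mul_assoc Xᵀ X, hX1, Matrix.one_mul,
    ← Matrix.mul_assoc, sub_self, neg_zero]

theorem grad_transpose_mul {n p : ℕ} (A : Matrix (Fin n) (Fin n) ℝ)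
    {X : Matrix (Fin n) (Fin p) ℝ} (hX : X ∈ stiefel n p) : (grad A X)ᵀ * X = 0 := by
  simpa [Matrix.transpose_mul] using congrArg Matrix.transpose (transpose_mul_grad A hX)

/-- Gradient dominance: `2 δ cos² θ_p (φ(X) - φ(W)) ≤ ‖grad φ(X)‖²`. -/
theorem gradient_dominance {n p : ℕ} (hp : 0 < p) (hpn : p < n)
    {A : Matrix (Fin n) (Fin n) ℝ} (hA : A.IsHermitian)
    (hgap : eig hA ⟨p, hpn⟩ < eig hA ⟨p - 1, (p.sub_le 1).trans_lt hpn⟩)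
    {W : Matrix (Fin n) (Fin p) ℝ} (hW : IsDominantBasis hA hpn.le W)
    {X : Matrix (Fin n) (Fin p) ℝ} (hX : X ∈ stiefel n p)
    {θ : Fin p → ℝ} (hθ : IsPrincipalAngles X W θ)
    (hcos : 0 < Real.cos (θ ⟨p - 1, Nat.sub_lt hp one_pos⟩)) :
    2 * (eig hA ⟨p - 1, (p.sub_le 1).trans_lt hpn⟩ - eig hA ⟨p, hpn⟩) * Real.cos (θ ⟨p - 1, Nat.sub_lt hp one_pos⟩) ^ 2 *
      (phi A X - phi A W) ≤ ((grad A X)ᵀ * grad A X).trace := by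
  obtain ⟨hmono, hIcc, U, hU, V, hV, hsvd⟩ := hθ
  obtain ⟨hS0, hgrow⟩ := phi_quadratic_growth hp hpn hA hgap hW hX
  have hX1 : Xᵀ * X = 1 := hX
  have hW1 : Wᵀ * W = 1 := hW.1
  have hAt : Aᵀ = A := by simpa using hA.eq
  have hU1 : Uᵀ * U = 1 := (Matrix.mem_orthogonalGroup_iff' _ _).mp hU
  have hV1 : Vᵀ * V = 1 := (Matrix.mem_orthogonalGroup_iff' _ _).mp hV
  have hV2 : V * Vᵀ = 1 := (Matrix.mem_orthogonalGroup_iff _ _).mp hV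
  have hle : ∀ i, Real.cos (θ ⟨p - 1, Nat.sub_lt hp one_pos⟩) ≤ Real.cos (θ i) := fun i =>
    Real.cos_le_cos_of_nonneg_of_le_pi (hIcc i).1
      ((hIcc _).2.trans (by linarith [Real.pi_pos])) (hmono (Fin.le_def.mpr (by simp; omega)))
  set cp := Real.cos (θ ⟨p - 1, Nat.sub_lt hp one_pos⟩) with hcp
  set c : Fin p → ℝ := fun i => Real.cos (θ i) with hc
  have hcpos : ∀ i, 0 < c i := fun i => hcos.trans_le (hle i)
  have hcc : Matrix.diagonal c * Matrix.diagonal (fun i => (c i)⁻¹) = 1 := by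
    rw [Matrix.diagonal_mul_diagonal, ← Matrix.diagonal_one]
    congr 1; funext i; exact mul_inv_cancel₀ (hcpos i).ne'
  -- The inverse of `Xᵀ W`, which exists because all cosines are positive.
  set N := U * Matrix.diagonal (fun i => (c i)⁻¹) * Vᵀ with hN
  have hM : Xᵀ * W = V * Matrix.diagonal c * Uᵀ := by
    have := congrArg Matrix.transpose hsvd
    simpa [Matrix.transpose_mul, Matrix.mul_assoc] using this
  have hMN : Xᵀ * W * N = 1 := by
    calc Xᵀ * W * N = V * Matrix.diagonal c * (Uᵀ * U) * Matrix.diagonal (fun i => (c i)⁻¹) * Vᵀ := by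
          rw [hM, hN]; simp only [Matrix.mul_assoc]
      _ = V * (Matrix.diagonal c * Matrix.diagonal (fun i => (c i)⁻¹)) * Vᵀ := by
          rw [hU1, Matrix.mul_one, Matrix.mul_assoc V]
      _ = 1 := by rw [hcc, Matrix.mul_one, hV2]
  have hNM : N * (Xᵀ * W) = 1 := mul_eq_one_comm.mp hMN
  have hNN : (Nᵀ * N).trace = ∑ i, (c i)⁻¹ ^ 2 := by
    have : Nᵀ * N = V * (Matrix.diagonal (fun i => (c i)⁻¹) * (Uᵀ * U) *
        Matrix.diagonal (fun i => (c i)⁻¹) * Vᵀ) := by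
      rw [hN]; simp [Matrix.transpose_mul, Matrix.mul_assoc]
    rw [this, Matrix.trace_mul_comm, hU1, Matrix.mul_one, Matrix.mul_assoc, hV1, Matrix.mul_one,
      Matrix.diagonal_mul_diagonal, Matrix.trace_diagonal]
    simp [pow_two]
  have hQQ : ((Wᵀ * X)ᵀ * (Wᵀ * X)).trace = ∑ i, c i ^ 2 := by
    have : (Wᵀ * X)ᵀ * (Wᵀ * X) = V * (Matrix.diagonal c * (Uᵀ * U) * Matrix.diagonal c * Vᵀ) := by
      rw [hsvd]; simp [Matrix.transpose_mul, Matrix.mul_assoc]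
    rw [this, Matrix.trace_mul_comm, hU1, Matrix.mul_one, Matrix.mul_assoc, hV1, Matrix.mul_one,
      Matrix.diagonal_mul_diagonal, Matrix.trace_diagonal]
    simp [pow_two]
  -- the test direction, of squared length `∑ tan² θᵢ`
  set Z := W * N - X with hZ
  have hXZ : Xᵀ * Z = 0 := by rw [hZ, Matrix.mul_sub, hX1, ← Matrix.mul_assoc, hMN, sub_self]
  have hZZ : (Zᵀ * Z).trace = ∑ i, ((c i)⁻¹ ^ 2 - 1) := by
    have h1 : Zᵀ * Z = Nᵀ * (Wᵀ * Z) := by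
      conv_lhs => rw [hZ]
      rw [Matrix.transpose_sub, Matrix.sub_mul, ← hZ, hXZ, sub_zero, Matrix.transpose_mul,
        Matrix.mul_assoc]
    have h2 : Wᵀ * Z = N - Wᵀ * X := by
      rw [hZ, Matrix.mul_sub, ← Matrix.mul_assoc, hW1, Matrix.one_mul]
    have h3 : Nᵀ * (Wᵀ * X) = 1 := by
      have := congrArg Matrix.transpose hMN
      simpa [Matrix.transpose_mul] using this
    rw [h1, h2, Matrix.mul_sub, h3, Matrix.trace_sub, hNN, Matrix.trace_one]
    simp
  -- Exact, with no remainder: `A W = W Λ` and `N (Xᵀ W) = 1` reduce the trace to `∑ λᵢ`.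
  have hGZ : ((grad A X)ᵀ * Z).trace = -(2 * (phi A X - phi A W)) := by
    have hGt : (grad A X)ᵀ = -(Xᵀ * A - (Xᵀ * A * X) * Xᵀ) := by
      simp [grad, Matrix.transpose_mul, hAt, Matrix.mul_assoc]
    have h1 : (grad A X)ᵀ * Z = -(Xᵀ * A * (W * N)) + Xᵀ * A * X := by
      rw [hZ, Matrix.mul_sub, grad_transpose_mul A hX, sub_zero, hGt, Matrix.neg_mul, Matrix.sub_mul,
        Matrix.mul_assoc (Xᵀ * A * X), ← Matrix.mul_assoc Xᵀ W N, hMN, Matrix.mul_one]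
      abel
    have h2 : (Xᵀ * A * (W * N)).trace = ∑ i : Fin p, eig hA (Fin.castLE hpn.le i) := by
      have : Xᵀ * A * (W * N) = Xᵀ * W *
          (Matrix.diagonal (fun i : Fin p => eig hA (Fin.castLE hpn.le i)) * N) := by
        rw [← Matrix.mul_assoc, Matrix.mul_assoc Xᵀ A W, hW.2]
        simp only [Matrix.mul_assoc]
      rw [this, Matrix.trace_mul_comm, Matrix.mul_assoc, hNM, Matrix.mul_one, Matrix.trace_diagonal]
    rw [h1, Matrix.trace_add, Matrix.trace_neg, h2, phi_dominant hpn.le hA hW, phi]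
    ring
  have hCS := trace_transpose_mul_sq_le (grad A X) Z
  rw [hGZ, hZZ] at hCS
  have hg := trace_transpose_mul_self_nonneg (grad A X)
  rw [hQQ] at hgrow hS0
  set g := ((grad A X)ᵀ * grad A X).trace
  set T := ∑ i, ((c i)⁻¹ ^ 2 - 1) with hT
  set D := phi A X - phi A W
  set d := eig hA ⟨p - 1, (p.sub_le 1).trans_lt hpn⟩ - eig hA ⟨p, hpn⟩ with hd
  have hdpos : 0 < d := sub_pos.mpr hgap
  -- Termwise, `cos²θ_p tan²θᵢ ≤ sin²θᵢ`, since `θ_p` is the largest angle.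
  have hTS : cp ^ 2 * T ≤ p - ∑ i, c i ^ 2 := by
    have : (p : ℝ) - ∑ i, c i ^ 2 = ∑ i : Fin p, (1 - c i ^ 2) := by
      rw [Finset.sum_sub_distrib]; simp
    rw [this, hT, Finset.mul_sum]
    refine Finset.sum_le_sum fun i _ => ?_
    have h1 : 1 - c i ^ 2 = c i ^ 2 * ((c i)⁻¹ ^ 2 - 1) := by
      have := (hcpos i).ne'
      field_simp
    rw [h1]
    have h2 : 1 ≤ (c i)⁻¹ := (one_le_inv₀ (hcpos i)).mpr (Real.cos_le_one _)
    refine mul_le_mul_of_nonneg_right (pow_le_pow_left₀ hcos.le (hle i) 2) ?_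
    nlinarith
  have hD : 0 ≤ D := by nlinarith [mul_nonneg hdpos.le hS0]
  have hT0 : 0 ≤ T := hZZ ▸ trace_transpose_mul_self_nonneg Z
  -- If `T = 0` there is nothing to divide by, but Cauchy–Schwarz then forces `D = 0`.
  rcases hT0.eq_or_lt with hT0 | hT0
  · have : D = 0 := by rw [← hT0] at hCS; nlinarith
    rw [this, mul_zero]; exact hg
  · refine le_of_mul_le_mul_right ?_ hT0
    have h1 : d * (cp ^ 2 * T) ≤ 2 * D := (mul_le_mul_of_nonneg_left hTS hdpos.le).trans hgrow
    nlinarith [mul_le_mul_of_nonneg_left h1 hD]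

/-! ### Sufficient decrease of one line-search step -/

theorem mul_orthogonal_mem_stiefel {n p : ℕ} {X : Matrix (Fin n) (Fin p) ℝ} (hX : X ∈ stiefel n p)
    {V : Matrix (Fin p) (Fin p) ℝ} (hV : Vᵀ * V = 1) : X * V ∈ stiefel n p := by
  have hX1 : Xᵀ * X = 1 := hX
  show (X * V)ᵀ * (X * V) = 1
  rw [Matrix.transpose_mul, Matrix.mul_assoc, ← Matrix.mul_assoc Xᵀ, hX1, Matrix.one_mul, hV]

theorem grad_mul_orthogonal {n p : ℕ} (A : Matrix (Fin n) (Fin n) ℝ) (X : Matrix (Fin n) (Fin p) ℝ)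
    {V : Matrix (Fin p) (Fin p) ℝ} (hV : V * Vᵀ = 1) : grad A (X * V) = grad A X * V := by
  have h : X * V * ((X * V)ᵀ * A * (X * V)) = X * (Xᵀ * A * X) * V := by
    calc X * V * ((X * V)ᵀ * A * (X * V)) = X * (V * Vᵀ) * (Xᵀ * A * X) * V := by
          simp only [Matrix.transpose_mul, Matrix.mul_assoc]
      _ = _ := by rw [hV, Matrix.mul_one]
  rw [grad, grad, h, Matrix.neg_mul, Matrix.sub_mul, Matrix.mul_assoc A]

/-- Source of the linear term of the line search: `A X = X C - G` and `Gᵀ X = 0`, so the cross terms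
of `(X - μG)ᵀ A (X - μG)` contribute `2μ GᵀG`. -/
theorem grad_transpose_mul_mul {n p : ℕ} (A : Matrix (Fin n) (Fin n) ℝ)
    {X : Matrix (Fin n) (Fin p) ℝ} (hX : X ∈ stiefel n p) :
    (grad A X)ᵀ * A * X = -((grad A X)ᵀ * grad A X) := by
  have h : A * X = X * (Xᵀ * A * X) - grad A X := by rw [grad]; abel
  rw [Matrix.mul_assoc, h, Matrix.mul_sub, ← Matrix.mul_assoc, grad_transpose_mul A hX,
    Matrix.zero_mul, zero_sub]

/-- The squared length of each column of the gradient is at most a quarter of the squared spread. -/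
theorem grad_transpose_mul_grad_apply_le {n p : ℕ} (hn : 0 < n) {A : Matrix (Fin n) (Fin n) ℝ}
    (hA : A.IsHermitian) {X : Matrix (Fin n) (Fin p) ℝ} (hX : X ∈ stiefel n p) (i : Fin p) :
    ((grad A X)ᵀ * grad A X) i i ≤
      (eig hA ⟨0, hn⟩ - eig hA ⟨n - 1, Nat.sub_lt hn one_pos⟩) ^ 2 / 4 := by
  have hX1 : Xᵀ * X = 1 := hX
  have hAt : Aᵀ = A := by simpa using hA.eq
  have hC : (Xᵀ * A * X)ᵀ = Xᵀ * A * X := by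
    simp [Matrix.transpose_mul, hAt, Matrix.mul_assoc]
  have h : (grad A X)ᵀ * grad A X = Xᵀ * (A * A) * X - (Xᵀ * A * X)ᵀ * (Xᵀ * A * X) := by
    rw [← neg_neg ((grad A X)ᵀ * grad A X), ← grad_transpose_mul_mul A hX, grad,
      Matrix.transpose_neg, Matrix.transpose_sub, Matrix.transpose_mul, Matrix.transpose_mul, hC,
      hAt]
    simp only [Matrix.neg_mul, Matrix.sub_mul, neg_neg, Matrix.mul_assoc]
  have h1 := sq_rayleigh_le hn hA X i
  -- A variance bound for a spectrum in `[λₙ, λ₁]`: dropping the off-diagonal entries of `C` leaves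
  -- at most `(λ₁ - c)(c - λₙ)` with `c = Cᵢᵢ`, which is at most `(λ₁ - λₙ)²/4`.
  have h2 : (Xᵀ * A * X) i i ^ 2 ≤ ((Xᵀ * A * X)ᵀ * (Xᵀ * A * X)) i i := by
    rw [transpose_mul_self_apply]
    exact Finset.single_le_sum (f := fun j => (Xᵀ * A * X) j i ^ 2)
      (fun j _ => sq_nonneg _) (Finset.mem_univ i)
  rw [hX1, Matrix.one_apply_eq] at h1
  rw [h, Matrix.sub_apply]
  nlinarith [sq_nonneg (2 * (Xᵀ * A * X) i i -
    (eig hA ⟨0, hn⟩ + eig hA ⟨n - 1, Nat.sub_lt hn one_pos⟩))]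

/-- The line-search function is `φ` along the retracted gradient ray. -/
theorem phi_retraction {n p : ℕ} {A : Matrix (Fin n) (Fin n) ℝ} (hA : A.IsHermitian)
    {X : Matrix (Fin n) (Fin p) ℝ} (hX : X ∈ stiefel n p) {V : Matrix (Fin p) (Fin p) ℝ}
    (hV : Vᵀ * V = 1) {β : Fin p → ℝ} (hβ : ((grad A X) * V)ᵀ * (grad A X * V) = Matrix.diagonal β)
    (μ : ℝ) :
    phi A ((X - μ • grad A X) * V *
      Matrix.diagonal (fun i => (Real.sqrt (1 + μ ^ 2 * β i))⁻¹) * Vᵀ) =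
    lineObjective (fun i => ((X * V)ᵀ * A * (X * V)) i i) β
        (fun i => ((grad A X * V)ᵀ * A * (grad A X * V)) i i) μ := by
  have hAt : Aᵀ = A := by simpa using hA.eq
  have hHY : (grad A X * V)ᵀ * A * (X * V) = -Matrix.diagonal β := by
    rw [← hβ, ← grad_mul_orthogonal A X (mul_eq_one_comm.mp hV)]
    exact grad_transpose_mul_mul A (mul_orthogonal_mem_stiefel hX hV)
  have hYH : (X * V)ᵀ * A * (grad A X * V) = -Matrix.diagonal β := by
    have := congrArg Matrix.transpose hHY
    rw [Matrix.transpose_neg, Matrix.diagonal_transpose] at this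
    rw [← this, Matrix.transpose_mul _ (X * V), Matrix.transpose_mul _ A, Matrix.transpose_transpose,
      hAt, Matrix.mul_assoc]
  have hβ0 : ∀ i, 0 ≤ β i := fun i => by
    have := congrFun (congrFun hβ i) i
    rw [transpose_mul_self_apply, Matrix.diagonal_apply_eq] at this
    rw [← this]
    exact Finset.sum_nonneg fun _ _ => sq_nonneg _
  set Y := X * V
  set H := grad A X * V
  have hYHμ : (X - μ • grad A X) * V = Y - μ • H := by
    rw [Matrix.sub_mul, Matrix.smul_mul]
  set d : Fin p → ℝ := fun i => (Real.sqrt (1 + μ ^ 2 * β i))⁻¹ with hd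
  set K := (Y - μ • H)ᵀ * A * (Y - μ • H) with hK
  have hKi : ∀ i, K i i = (Yᵀ * A * Y) i i + 2 * β i * μ + (Hᵀ * A * H) i i * μ ^ 2 := by
    intro i
    have : K = Yᵀ * A * Y - μ • (Yᵀ * A * H) - μ • (Hᵀ * A * Y) + μ • μ • (Hᵀ * A * H) := by
      rw [hK]
      simp only [Matrix.transpose_sub, Matrix.transpose_smul, Matrix.sub_mul, Matrix.mul_sub,
        Matrix.smul_mul, Matrix.mul_smul, smul_sub]
      abel
    rw [this, hYH, hHY]
    simp
    ring
  -- The outer `Vᵀ` cancels under the trace and the scaling is diagonal, so only the diagonal of `K`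
  -- matters.
  have htr : ((((Y - μ • H) * Matrix.diagonal d * Vᵀ)ᵀ * A *
      ((Y - μ • H) * Matrix.diagonal d * Vᵀ))).trace = ∑ i, d i * K i i * d i := by
    have : ((Y - μ • H) * Matrix.diagonal d * Vᵀ)ᵀ * A * ((Y - μ • H) * Matrix.diagonal d * Vᵀ)
        = V * (Matrix.diagonal d * K * Matrix.diagonal d * Vᵀ) := by
      rw [hK]
      simp only [Matrix.transpose_mul, Matrix.transpose_transpose, Matrix.diagonal_transpose,
        Matrix.mul_assoc]
    rw [this, Matrix.trace_mul_comm, Matrix.mul_assoc, hV, Matrix.mul_one]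
    simp [Matrix.trace, Matrix.mul_diagonal, Matrix.diagonal_mul]
  rw [hYHμ, phi, lineObjective, htr]
  congr 1
  refine Finset.sum_congr rfl fun i _ => ?_
  have h0 : 0 < 1 + μ ^ 2 * β i := by nlinarith [mul_nonneg (sq_nonneg μ) (hβ0 i)]
  have hdd : d i * d i = (1 + β i * μ ^ 2)⁻¹ := by
    rw [hd]
    simp only
    rw [← mul_inv, Real.mul_self_sqrt h0.le, mul_comm (β i)]
  rw [← hKi, div_eq_mul_inv, ← hdd]
  ring

/-- One step of exact line search decreases `φ` by at least `2 / (5 L)` times the squared gradient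
norm. -/
theorem phi_step_le {n p : ℕ} (hn : 0 < n) {A : Matrix (Fin n) (Fin n) ℝ} (hA : A.IsHermitian)
    {L : ℝ} (hL : L = eig hA ⟨0, hn⟩ - eig hA ⟨n - 1, Nat.sub_lt hn one_pos⟩) (hL0 : 0 < L)
    {X X' : Matrix (Fin n) (Fin p) ℝ} (hX : X ∈ stiefel n p) (hstep : IsGradientStep A X X') :
    phi A X' ≤ phi A X - 2 / (5 * L) * ((grad A X)ᵀ * grad A X).trace := by
  obtain ⟨V, hVmem, β, μ, hGG, -, hmin, rfl⟩ := hstep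
  have hV : Vᵀ * V = 1 := (Matrix.mem_orthogonalGroup_iff' _ _).mp hVmem
  have hV' : V * Vᵀ = 1 := (Matrix.mem_orthogonalGroup_iff _ _).mp hVmem
  have hβ : (grad A X * V)ᵀ * (grad A X * V) = Matrix.diagonal β := by
    calc (grad A X * V)ᵀ * (grad A X * V) = Vᵀ * ((grad A X)ᵀ * grad A X) * V := by
          simp only [Matrix.transpose_mul, Matrix.mul_assoc]
      _ = (Vᵀ * V) * Matrix.diagonal β * (Vᵀ * V) := by
          rw [hGG]; simp only [Matrix.mul_assoc]
      _ = _ := by rw [hV, Matrix.one_mul, Matrix.mul_one]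
  have hY := mul_orthogonal_mem_stiefel hX hV
  have hY1 : (X * V)ᵀ * (X * V) = 1 := hY
  rw [phi_retraction hA hX hV hβ]
  have htr : ((grad A X)ᵀ * grad A X).trace = ∑ i, β i := by
    rw [hGG, Matrix.mul_assoc, Matrix.trace_mul_comm, Matrix.mul_assoc, hV, Matrix.mul_one,
      Matrix.trace_diagonal]
  have hphi : phi A X = -(1 / 2) * ∑ i, ((X * V)ᵀ * A * (X * V)) i i := by
    have : (X * V)ᵀ * A * (X * V) = Vᵀ * (Xᵀ * A * X * V) := by
      simp only [Matrix.transpose_mul, Matrix.mul_assoc]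
    have h2 : ∑ i, ((X * V)ᵀ * A * (X * V)) i i = ((X * V)ᵀ * A * (X * V)).trace := rfl
    rw [h2, this, Matrix.trace_mul_comm, Matrix.mul_assoc, hV', Matrix.mul_one, phi]
  -- Trial step `1/L`.
  have hle := hmin (show (1 / L : ℝ) ∈ Set.Ici 0 from (one_div_pos.mpr hL0).le)
  refine hle.trans ?_
  rw [lineObjective, htr, hphi]
  have hsum : ∑ i, (((X * V)ᵀ * A * (X * V)) i i + 4 / (5 * L) * β i) ≤
      ∑ i, (((X * V)ᵀ * A * (X * V)) i i + 2 * β i * (1 / L) +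
        ((grad A X * V)ᵀ * A * (grad A X * V)) i i * (1 / L) ^ 2) / (1 + β i * (1 / L) ^ 2) := by
    refine Finset.sum_le_sum fun i _ => ?_
    have hβi : ((grad A X * V)ᵀ * (grad A X * V)) i i = β i := by
      rw [hβ, Matrix.diagonal_apply_eq]
    have hβ0 : 0 ≤ β i := by
      rw [← hβi, transpose_mul_self_apply]
      exact Finset.sum_nonneg fun _ _ => sq_nonneg _
    have hβL : β i ≤ L ^ 2 / 4 := by
      rw [← hβi, hL, ← grad_mul_orthogonal A X hV']
      exact grad_transpose_mul_grad_apply_le hn hA hY i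
    have hα := rayleigh_le hn hA (X * V) i
    have hγ := le_rayleigh hn hA (grad A X * V) i
    rw [hY1, Matrix.one_apply_eq, mul_one] at hα
    rw [hβi] at hγ
    generalize ((X * V)ᵀ * A * (X * V)) i i = a at *
    generalize ((grad A X * V)ᵀ * A * (grad A X * V)) i i = c at *
    generalize β i = b at *
    -- From `a ≤ λ₁` follows `a - L ≤ λₙ`, and `c ≥ λₙ b`.
    have hc : a * b - L * b ≤ c := by
      rw [hL]; nlinarith [mul_le_mul_of_nonneg_right hα hβ0]
    rw [le_div_iff₀ (by positivity)]
    -- The gain over `a` is at least `(b/L) / (1 + b/L²)`; the bound `b ≤ L²/4` makes the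
    -- denominator at most `5/4`, whence `4/5`.
    have key : (a + 2 * b * (1 / L) + c * (1 / L) ^ 2) - (a + 4 / (5 * L) * b) * (1 + b * (1 / L) ^ 2)
        = (L * (c - (a * b - L * b)) + 4 / 5 * b * (L ^ 2 / 4 - b)) / L ^ 3 := by
      field_simp
      ring
    have hnn : 0 ≤ (L * (c - (a * b - L * b)) + 4 / 5 * b * (L ^ 2 / 4 - b)) / L ^ 3 :=
      div_nonneg (add_nonneg (mul_nonneg hL0.le (sub_nonneg.mpr hc))
        (mul_nonneg (mul_nonneg (by norm_num) hβ0) (sub_nonneg.mpr hβL))) (by positivity)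
    linarith
  rw [Finset.sum_add_distrib, ← Finset.mul_sum] at hsum
  have h4 : (4 : ℝ) / (5 * L) = 2 * (2 / (5 * L)) := by ring
  rw [h4] at hsum
  linarith

/-! ### From the cosine to the angle factor -/

/-- Since `2 c_Q = (2/π)²` and `t / tan t = (t / sin t) cos t`, this is the square of Jordan's
inequality `(2/π) t ≤ sin t` times `cos t`. -/
theorem two_mul_cQ_mul_angleFactor_sq_le {t : ℝ} (ht : t ∈ Set.Icc 0 (Real.pi / 2)) :
    2 * cQ * angleFactor t ^ 2 ≤ Real.cos t ^ 2 := by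
  have hpi := Real.pi_pos
  have h2 : 2 * cQ = (2 / Real.pi) ^ 2 := by rw [cQ]; ring
  rw [h2, ← mul_pow]
  have hcos : 0 ≤ Real.cos t := Real.cos_nonneg_of_mem_Icc ⟨by linarith [ht.1], ht.2⟩
  unfold angleFactor
  split_ifs with h0 h1
  · rw [h0, Real.cos_zero]
    refine pow_le_pow_left₀ (by positivity) ?_ 2
    rw [mul_one, div_le_one hpi]
    exact Real.two_le_pi
  · simp [h1]
  · have ht0 : 0 < t := lt_of_le_of_ne ht.1 (Ne.symm h0)
    have hs : 0 < Real.sin t := Real.sin_pos_of_pos_of_lt_pi ht0 (by linarith [ht.2])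
    have hJ : 2 / Real.pi * t ≤ Real.sin t := Real.mul_le_sin ht.1 ht.2
    have : 2 / Real.pi * (t / Real.tan t) = (2 / Real.pi * t) / Real.sin t * Real.cos t := by
      rw [Real.tan_eq_sin_div_cos, div_div_eq_mul_div]; ring
    rw [this]
    refine pow_le_pow_left₀ (by positivity) ?_ 2
    exact mul_le_of_le_one_left hcos ((div_le_one hs).mpr hJ)

end GrassmannGD

/-! ### Combining decrease and dominance -/

theorem mainTheorem2 {n p : ℕ} (hp : 0 < p) (hpn : p < n)
    (A : Matrix (Fin n) (Fin n) ℝ) (hA : A.IsHermitian)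
    (δ L : ℝ)
    (hδ : δ = GrassmannGD.eig hA ⟨p - 1, by omega⟩ - GrassmannGD.eig hA ⟨p, hpn⟩)
    (hgap : 0 < δ)
    (hL : L = GrassmannGD.eig hA ⟨0, by omega⟩ - GrassmannGD.eig hA ⟨n - 1, by omega⟩)
    (W : Matrix (Fin n) (Fin p) ℝ) (hW : GrassmannGD.IsDominantBasis hA hpn.le W)
    (X X' : Matrix (Fin n) (Fin p) ℝ) (hX : X ∈ GrassmannGD.stiefel n p)
    (hstep : GrassmannGD.IsGradientStep A X X')
    (θ : Fin p → ℝ) (hθ : GrassmannGD.IsPrincipalAngles X W θ) :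
    GrassmannGD.phi A X' - GrassmannGD.phiStar A p ≤
      (1 - 8 / 5 * GrassmannGD.cQ *
          GrassmannGD.angleFactor (θ ⟨p - 1, by omega⟩) ^ 2 * (δ / L)) *
        (GrassmannGD.phi A X - GrassmannGD.phiStar A p) := by
  have hgap' : GrassmannGD.eig hA ⟨p, hpn⟩ < GrassmannGD.eig hA ⟨p - 1, by omega⟩ := by linarith
  have hL0 : 0 < L := by
    have h1 : GrassmannGD.eig hA ⟨p - 1, by omega⟩ ≤ GrassmannGD.eig hA ⟨0, by omega⟩ :=
      GrassmannGD.eig_antitone hA (Fin.mk_le_of_le_val (Nat.zero_le _))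
    have h2 : GrassmannGD.eig hA ⟨n - 1, by omega⟩ ≤ GrassmannGD.eig hA ⟨p, hpn⟩ :=
      GrassmannGD.eig_antitone hA (Fin.le_def.mpr (by simp; omega))
    linarith
  have hdec := GrassmannGD.phi_step_le (by omega) hA hL hL0 hX hstep
  have hstar := GrassmannGD.phi_dominant_le_phiStar hp hpn hA hgap' hW
  have hangle := GrassmannGD.two_mul_cQ_mul_angleFactor_sq_le (hθ.2.1 ⟨p - 1, by omega⟩)
  have hcos : 0 ≤ Real.cos (θ ⟨p - 1, by omega⟩) := Real.cos_nonneg_of_mem_Icc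
    ⟨by linarith [(hθ.2.1 ⟨p - 1, by omega⟩).1, Real.pi_pos], (hθ.2.1 ⟨p - 1, by omega⟩).2⟩
  have hdom : 2 * δ * Real.cos (θ ⟨p - 1, by omega⟩) ^ 2 *
      (GrassmannGD.phi A X - GrassmannGD.phi A W) ≤
      ((GrassmannGD.grad A X)ᵀ * GrassmannGD.grad A X).trace := by
    -- At `θ_p = π/2` the matrix `Xᵀ W` is singular and the test direction is undefined, but the
    -- left side vanishes.
    rcases hcos.eq_or_lt with h | h
    · rw [← h]
      simpa using GrassmannGD.trace_transpose_mul_self_nonneg (GrassmannGD.grad A X)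
    · rw [hδ]
      exact GrassmannGD.gradient_dominance hp hpn hA hgap' hW hX hθ h
  have hD : 0 ≤ GrassmannGD.phi A X - GrassmannGD.phi A W := by
    obtain ⟨h1, h2⟩ := GrassmannGD.phi_quadratic_growth hp hpn hA hgap' hW hX
    rw [← hδ] at h2
    nlinarith [mul_nonneg hgap.le h1]
  set κ := 2 * GrassmannGD.cQ * GrassmannGD.angleFactor (θ ⟨p - 1, by omega⟩) ^ 2 with hκ
  have hκ0 : 0 ≤ κ := by
    rw [hκ, GrassmannGD.cQ]; positivity
  have h1 : κ * (GrassmannGD.phi A X - GrassmannGD.phiStar A p) ≤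
      Real.cos (θ ⟨p - 1, by omega⟩) ^ 2 * (GrassmannGD.phi A X - GrassmannGD.phi A W) :=
    (mul_le_mul_of_nonneg_left (by linarith) hκ0).trans (mul_le_mul_of_nonneg_right hangle hD)
  have h2 : 2 / (5 * L) * (2 * δ * (κ * (GrassmannGD.phi A X - GrassmannGD.phiStar A p))) ≤
      2 / (5 * L) * ((GrassmannGD.grad A X)ᵀ * GrassmannGD.grad A X).trace := by
    refine mul_le_mul_of_nonneg_left (le_trans ?_ hdom) (by positivity)
    rw [mul_assoc (2 * δ) (Real.cos _ ^ 2)]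
    exact mul_le_mul_of_nonneg_left h1 (by positivity)
  have h3 : 8 / 5 * GrassmannGD.cQ * GrassmannGD.angleFactor (θ ⟨p - 1, by omega⟩) ^ 2 * (δ / L) *
      (GrassmannGD.phi A X - GrassmannGD.phiStar A p) =
      2 / (5 * L) * (2 * δ * (κ * (GrassmannGD.phi A X - GrassmannGD.phiStar A p))) := by
    rw [hκ]
    field_simp
    ring
  rw [sub_mul, h3, one_mul]
  linarith
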